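/- Let $\mathcal{X}$ be a complete separable metric space equipped with its Borel $\sigma$-field $\mathcal{S}$, and let $\mathcal{C}\subseteq\mathcal{S}$ be a countable family of sets with finite VC dimension, that is, there is an integer $V$ such that every finite set $D\subseteq\mathcal{X}$ with $|\{C\cap D : C\in\mathcal{C}\}| = 2^{|D|}$ has at most $V$ elements. Then for every stationary ergodic process $\mathbf{X}=X_1,X_2,\ldots$ taking values in $(\mathcal{X},\mathcal{S})$ (that is, $(X_2,X_3,\ldots)$ has the same law as $(X_1,X_2,\ldots)$, and every shift-invariant measurable set of sequences contains the path of $\mathbf{X}$ with probability $0$ or $1$), \[ \Gamma_m(\mathcal{C}:\mathbf{X}) = \sup_{C\in\mathcal{C}} \left| \frac1m \sum_{i=1}^m I(X_i\in C) - \mathbb{P}(X_1\in C)\right| \to 0 \quad\text{with probability one as } m\to\infty . \] In other words, $\mathcal{C}$ is a Glivenko–Cantelli class for every stationary ergodic process. -/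

import Mathlib

open MeasureTheory ProbabilityTheory Filter Topology
open scoped ENNReal

namespace ErgodicVC

noncomputable section

/-- The shatter coefficient `S(D : 𝒞)`: the number of distinct sets `C ∩ D` with `C ∈ 𝒞`. -/
def shatterCoeff {S : Type*} (D : Finset S) (𝒞 : Set (Set S)) : ℕ :=
  Set.ncard ((fun C : Set S => C ∩ (D : Set S)) '' 𝒞)

/-- The family `𝒞` shatters the finite set `D` if `S(D : 𝒞) = 2 ^ |D|`. -/
def Shatters {S : Type*} (𝒞 : Set (Set S)) (D : Finset S) : Prop :=
  shatterCoeff D 𝒞 = 2 ^ D.card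

/-- The VC dimension: the supremum in `ℕ∞` of the cardinalities of the finite sets
shattered by `𝒞` (it is `0` if `𝒞` shatters no nonempty finite set). -/
def vcDim {S : Type*} (𝒞 : Set (Set S)) : ℕ∞ :=
  ⨆ (D : Finset S) (_ : Shatters 𝒞 D), (D.card : ℕ∞)

/-- The left shift on one-sided sequences. -/
def shift {S : Type*} (x : ℕ → S) : ℕ → S := fun n => x (n + 1)

/-- The process `X 0, X 1, …` is stationary: `(X 1, X 2, …)` has the same law on the
sequence space as `(X 0, X 1, …)`. -/
def IsStationary {Ω S : Type*} [MeasurableSpace Ω] [MeasurableSpace S]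
    (X : ℕ → Ω → S) (P : Measure Ω) : Prop :=
  IdentDistrib (fun ω n => X (n + 1) ω) (fun ω n => X n ω) P P

/-- The invariant sigma-field of the process is trivial: every shift-invariant measurable
set of sequences contains the path of the process with probability `0` or `1`. -/
def IsErgodic {Ω S : Type*} [MeasurableSpace Ω] [MeasurableSpace S]
    (X : ℕ → Ω → S) (P : Measure Ω) : Prop :=
  ∀ B : Set (ℕ → S), MeasurableSet B → shift ⁻¹' B = B →
    P {ω | (fun n => X n ω) ∈ B} = 0 ∨ P {ω | (fun n => X n ω) ∈ B} = 1

/-- The relative frequency of `C` among the first `m` samples `X 0, …, X (m - 1)`. -/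
def relFreq {Ω S : Type*} (X : ℕ → Ω → S) (C : Set S) (m : ℕ) (ω : Ω) : ℝ :=
  (1 / (m : ℝ)) * ∑ i ∈ Finset.range m, C.indicator (fun _ => (1 : ℝ)) (X i ω)

/-- `Γ_m(𝒞 : X)`: the supremum over `C ∈ 𝒞` of the distance between the relative frequency
of `C` and its probability under the common law of the samples. -/
def Gam {Ω S : Type*} [MeasurableSpace Ω] (P : Measure Ω)
    (𝒞 : Set (Set S)) (X : ℕ → Ω → S) (m : ℕ) (ω : Ω) : ℝ :=
  ⨆ C : 𝒞, |relFreq X (C : Set S) m ω - P.real {ω' | X 0 ω' ∈ (C : Set S)}|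

/-- `𝒞` is a Glivenko–Cantelli class for the process `X`. -/
def IsGlivenkoCantelli {Ω S : Type*} [MeasurableSpace Ω] (P : Measure Ω)
    (𝒞 : Set (Set S)) (X : ℕ → Ω → S) : Prop :=
  ∀ᵐ ω ∂P, Tendsto (fun m : ℕ => Gam P 𝒞 X m ω) atTop (𝓝 0)

/-- The terms of the supremum in `Gam` are bounded by `1`, so that for a probability measure
the real supremum is the genuine one. -/
theorem bddAbove_Gam {Ω S : Type*} [MeasurableSpace Ω] (P : Measure Ω)
    [IsProbabilityMeasure P] (𝒞 : Set (Set S)) (X : ℕ → Ω → S) (m : ℕ) (ω : Ω) :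
    BddAbove (Set.range fun C : 𝒞 =>
      |relFreq X (C : Set S) m ω - P.real {ω' | X 0 ω' ∈ (C : Set S)}|) := by
  refine ⟨1, ?_⟩
  rintro _ ⟨C, rfl⟩
  have h0 : 0 ≤ relFreq X (C : Set S) m ω :=
    mul_nonneg (by positivity)
      (Finset.sum_nonneg fun i _ => Set.indicator_nonneg (fun _ _ => zero_le_one) _)
  have h1 : relFreq X (C : Set S) m ω ≤ 1 := by
    have hs : ∑ i ∈ Finset.range m, (C : Set S).indicator (fun _ => (1 : ℝ)) (X i ω) ≤ m := by
      calc _ ≤ ∑ i ∈ Finset.range m, (1 : ℝ) :=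
            Finset.sum_le_sum fun i _ => Set.indicator_le_self' (fun _ _ => zero_le_one) _
        _ = m := by simp
    unfold relFreq
    rw [one_div, inv_mul_eq_div]
    exact div_le_one_of_le₀ hs (Nat.cast_nonneg m)
  have h2 : 0 ≤ P.real {ω' | X 0 ω' ∈ (C : Set S)} := measureReal_nonneg
  have h3 : P.real {ω' | X 0 ω' ∈ (C : Set S)} ≤ 1 := measureReal_le_one
  exact abs_le.2 ⟨by linarith, by linarith⟩

end

end ErgodicVC

/-! Finite VC dimension forces finite bracketing: for the common law `μ` of the samples and every
`ε`, finitely many pairs of measurable sets whose differences have measure below `ε` enclose every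
member of `𝒞` up to null sets (`exists_finite_brackets`). Birkhoff's theorem
(`ae_tendsto_birkhoffAverage`) then controls the finitely many endpoints, and monotonicity of
relative frequencies carries this to all of `𝒞`.

Bracketing is a compactness argument in the space of ultrafilters on `Set S`. Along an ultrafilter
containing `𝒞`, take a maximal region where the sets agree a.e. with a fixed set. If the rest `W`
were non-null, ultrafilter-most members of `𝒞` would split each non-null part of `W`; iterating
gives Boolean independent families of every finite size, hence arbitrarily large shattered sets. So
`W` is null, each ultrafilter yields one bracket, and compactness leaves finitely many. -/

namespace ErgodicVC

/-! ### Birkhoff's ergodic theorem, through the maximal ergodic theorem. -/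

section Birkhoff

variable {α : Type*}

/-- The running maximum of `0` and the first `n` Birkhoff sums of `f`, defined recursively. -/
def birkhoffMax (T : α → α) (f : α → ℝ) : ℕ → α → ℝ
  | 0 => 0
  | n + 1 => fun x => max 0 (f x + birkhoffMax T f n (T x))

theorem birkhoffMax_nonneg (T : α → α) (f : α → ℝ) (n : ℕ) (x : α) :
    0 ≤ birkhoffMax T f n x := by
  cases n with
  | zero => exact le_rfl
  | succ n => exact le_max_left _ _

theorem birkhoffMax_le_succ (T : α → α) (f : α → ℝ) (n : ℕ) (x : α) :
    birkhoffMax T f n x ≤ birkhoffMax T f (n + 1) x := by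
  induction n generalizing x with
  | zero => exact birkhoffMax_nonneg T f 1 x
  | succ n ih => exact max_le_max le_rfl (add_le_add le_rfl (ih (T x)))

theorem birkhoffSum_le_birkhoffMax (T : α → α) (f : α → ℝ) (n : ℕ) (x : α) :
    birkhoffSum T f n x ≤ birkhoffMax T f n x := by
  induction n generalizing x with
  | zero => simp [birkhoffMax]
  | succ n ih =>
    rw [birkhoffSum_succ']
    exact (add_le_add le_rfl (ih (T x))).trans (le_max_right _ _)

variable [MeasurableSpace α] {ν : Measure α} {T : α → α} {f : α → ℝ}

theorem measurable_birkhoffMax (hT : Measurable T) (hf : Measurable f) (n : ℕ) :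
    Measurable (birkhoffMax T f n) := by
  induction n with
  | zero => exact measurable_const
  | succ n ih => exact measurable_const.max (hf.add (ih.comp hT))

theorem integrable_birkhoffMax (hT : MeasurePreserving T ν ν) (hf : Integrable f ν) (n : ℕ) :
    Integrable (birkhoffMax T f n) ν := by
  induction n with
  | zero => exact integrable_zero _ _ _
  | succ n ih =>
    exact (integrable_zero α ℝ ν).sup (hf.add (hT.integrable_comp_of_integrable ih))

/-- The maximal ergodic theorem. -/
theorem setIntegral_nonneg_of_birkhoffMax_pos (hT : MeasurePreserving T ν ν)
    (hfm : Measurable f) (hf : Integrable f ν) (n : ℕ) :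
    0 ≤ ∫ x in {x | 0 < birkhoffMax T f n x}, f x ∂ν := by
  cases n with
  | zero => simp [birkhoffMax]
  | succ n =>
    set M := birkhoffMax T f (n + 1) with hM
    have hMi : Integrable M ν := integrable_birkhoffMax hT hf _
    have hMTi : Integrable (fun x => M (T x)) ν := hT.integrable_comp_of_integrable hMi
    have hE : MeasurableSet {x | 0 < M x} :=
      measurableSet_lt measurable_const (measurable_birkhoffMax hT.measurable hfm _)
    -- Where `M > 0` the maximum is not attained by `0`, so `f` dominates `M - M ∘ T` there. The
    -- integral of this difference is nonnegative: `M` vanishes off the set, `M ∘ T ≥ 0`, and `T`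
    -- preserves `ν`.
    have h1 : ∫ x in {x | 0 < M x}, (M x - M (T x)) ∂ν ≤ ∫ x in {x | 0 < M x}, f x ∂ν := by
      refine setIntegral_mono_on (hMi.sub hMTi).integrableOn hf.integrableOn hE fun x hx => ?_
      have h2 : M x = max 0 (f x + birkhoffMax T f n (T x)) := rfl
      have h3 : M x = f x + birkhoffMax T f n (T x) := by
        rcases max_choice 0 (f x + birkhoffMax T f n (T x)) with h | h
        · rw [h] at h2
          exact absurd hx (by simp [h2])
        · rw [h2, h]
      have h4 : birkhoffMax T f n (T x) ≤ M (T x) := birkhoffMax_le_succ T f n (T x)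
      linarith
    have h5 : ∫ x in {x | 0 < M x}, M x ∂ν = ∫ x, M x ∂ν := by
      refine setIntegral_eq_integral_of_forall_compl_eq_zero fun x hx => ?_
      exact le_antisymm (not_lt.1 hx) (birkhoffMax_nonneg T f _ x)
    have h6 : ∫ x in {x | 0 < M x}, M (T x) ∂ν ≤ ∫ x, M (T x) ∂ν :=
      setIntegral_le_integral hMTi (ae_of_all _ fun x => birkhoffMax_nonneg T f _ (T x))
    have h7 : ∫ x, M (T x) ∂ν = ∫ x, M x ∂ν := by
      have := integral_map (μ := ν) (φ := T) hT.measurable.aemeasurable (f := M)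
        (by rw [hT.map_eq]; exact hMi.aestronglyMeasurable)
      rw [hT.map_eq] at this
      exact this.symm
    rw [integral_sub hMi.integrableOn hMTi.integrableOn] at h1
    linarith

/-- If almost every point has a positive Birkhoff sum of `f`, then `f` has nonnegative mean. -/
theorem integral_nonneg_of_ae_exists_birkhoffSum_pos (hT : MeasurePreserving T ν ν)
    (hfm : Measurable f) (hf : Integrable f ν)
    (h : ∀ᵐ x ∂ν, ∃ n, 0 < birkhoffSum T f n x) : 0 ≤ ∫ x, f x ∂ν := by
  have hlim := tendsto_setIntegral_of_monotone (μ := ν) (f := f)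
    (s := fun n => {x | 0 < birkhoffMax T f n x})
    (fun n => measurableSet_lt measurable_const (measurable_birkhoffMax hT.measurable hfm n))
    (monotone_nat_of_le_succ fun n x hx => lt_of_lt_of_le hx (birkhoffMax_le_succ T f n x))
    hf.integrableOn
  have hU : ∫ x in ⋃ n, {x | 0 < birkhoffMax T f n x}, f x ∂ν = ∫ x, f x ∂ν := by
    rw [Measure.restrict_eq_self_of_ae_mem]
    filter_upwards [h] with x ⟨n, hn⟩
    exact Set.mem_iUnion.2 ⟨n, lt_of_lt_of_le hn (birkhoffSum_le_birkhoffMax T f n x)⟩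
  rw [hU] at hlim
  exact ge_of_tendsto' hlim (setIntegral_nonneg_of_birkhoffMax_pos hT hfm hf)

theorem measurable_birkhoffAverage (hT : Measurable T) (hf : Measurable f) (n : ℕ) :
    Measurable (birkhoffAverage ℝ T f n) := by
  have : birkhoffAverage ℝ T f n =
      fun x => (n : ℝ)⁻¹ * ∑ k ∈ Finset.range n, f (T^[k] x) := rfl
  rw [this]
  exact (Finset.measurable_sum _ fun k _ => hf.comp (hT.iterate k)).const_mul _

/-- The set where the upper limit of the averages exceeds `c` is invariant, so null or conull. If
conull, almost every point has a positive Birkhoff sum of `f - c`, and the maximal theorem gives `c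
≤ ∫ f`, a contradiction. -/
theorem ae_eventually_birkhoffAverage_le [IsProbabilityMeasure ν] (hT : Ergodic T ν)
    (hfm : Measurable f) (hb : Bornology.IsBounded (Set.range f)) (hf : Integrable f ν)
    {c : ℝ} (hc : ∫ x, f x ∂ν < c) :
    ∀ᵐ x ∂ν, ∀ q : ℚ, c < q → ∀ᶠ n in atTop, birkhoffAverage ℝ T f n x ≤ q := by
  set E : Set α := {x | ∃ q : ℚ, c < q ∧ ∃ᶠ n in atTop, (q : ℝ) < birkhoffAverage ℝ T f n x}
    with hEdef
  have hEm : MeasurableSet E := by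
    have : E = ⋃ q : ℚ, ⋃ _ : c < q, ⋂ N : ℕ, ⋃ n : ℕ, ⋃ _ : N ≤ n,
        {x | (q : ℝ) < birkhoffAverage ℝ T f n x} := by
      ext x
      simp [hEdef, frequently_atTop]
    rw [this]
    refine .iUnion fun q => .iUnion fun _ => .iInter fun N => .iUnion fun n => .iUnion fun _ => ?_
    exact measurableSet_lt measurable_const (measurable_birkhoffAverage hT.measurable hfm n)
  -- Lowering `q` to a rational `r` still above `c` absorbs the vanishing difference between the
  -- averages at `x` and at `T x`; hence `E` is exactly invariant.
  have key : ∀ u v : ℕ → ℝ, Tendsto (fun n => u n - v n) atTop (𝓝 0) →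
      (∃ q : ℚ, c < q ∧ ∃ᶠ n in atTop, (q : ℝ) < u n) →
      ∃ q : ℚ, c < q ∧ ∃ᶠ n in atTop, (q : ℝ) < v n := by
    rintro u v huv ⟨q, hcq, hq⟩
    obtain ⟨r, hcr, hrq⟩ := exists_rat_btwn hcq
    refine ⟨r, hcr, ?_⟩
    have hev : ∀ᶠ n in atTop, u n - v n < q - r := huv.eventually_lt_const (by linarith)
    exact (hq.and_eventually hev).mono fun n hn => by linarith [hn.1, hn.2]
  have hinv : T ⁻¹' E = E := by
    ext x
    have hx := tendsto_birkhoffAverage_apply_sub_birkhoffAverage' ℝ hb T x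
    constructor
    · exact key _ _ hx
    · refine key _ _ ?_
      simpa using hx.neg
  rcases hT.toPreErgodic.ae_mem_or_ae_notMem hEm hinv with h | h
  · exfalso
    have hg := integral_nonneg_of_ae_exists_birkhoffSum_pos (f := fun x => f x - c)
      hT.toMeasurePreserving (hfm.sub_const c) (hf.sub (integrable_const c)) (by
        filter_upwards [h] with x ⟨q, hcq, hq⟩
        obtain ⟨n, hn, hn0⟩ := (hq.and_eventually (eventually_gt_atTop 0)).exists
        refine ⟨n, ?_⟩
        have hn0' : (0 : ℝ) < n := by exact_mod_cast hn0
        have h1 : birkhoffSum T (fun x => f x - c) n x = birkhoffSum T f n x - n * c := by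
          simp [birkhoffSum, Finset.sum_sub_distrib]
        have h2 : birkhoffAverage ℝ T f n x = birkhoffSum T f n x / n := by
          simp [birkhoffAverage, div_eq_inv_mul]
        rw [h2, lt_div_iff₀ hn0'] at hn
        rw [h1]
        nlinarith)
    rw [integral_sub hf (integrable_const c)] at hg
    simp at hg
    linarith
  · filter_upwards [h] with x hx q hq
    by_contra hcon
    refine hx ⟨q, hq, ?_⟩
    simpa only [Filter.not_eventually, not_le] using hcon

/-- Birkhoff's pointwise ergodic theorem for bounded functions. -/
theorem ae_tendsto_birkhoffAverage [IsProbabilityMeasure ν] (hT : Ergodic T ν)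
    (hfm : Measurable f) (hb : Bornology.IsBounded (Set.range f)) :
    ∀ᵐ x ∂ν, Tendsto (fun n => birkhoffAverage ℝ T f n x) atTop (𝓝 (∫ x, f x ∂ν)) := by
  have upper : ∀ g : α → ℝ, Measurable g → Bornology.IsBounded (Set.range g) →
      ∀ᵐ x ∂ν, ∀ c : ℝ, ∫ x, g x ∂ν < c → ∀ᶠ n in atTop, birkhoffAverage ℝ T g n x < c := by
    intro g hgm hgb
    have hgi : Integrable g ν := by
      obtain ⟨K, hK⟩ := hgb.exists_norm_le
      exact .of_bound hgm.aestronglyMeasurable K (ae_of_all _ fun x => hK _ ⟨x, rfl⟩)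
    have h : ∀ᵐ x ∂ν, ∀ r : ℚ, ∫ x, g x ∂ν < r → ∀ q : ℚ, (r : ℝ) < q →
        ∀ᶠ n in atTop, birkhoffAverage ℝ T g n x ≤ q := by
      refine ae_all_iff.2 fun r => ?_
      by_cases hr : ∫ x, g x ∂ν < r
      · filter_upwards [ae_eventually_birkhoffAverage_le hT hgm hgb hgi hr] with x hx _ using hx
      · exact ae_of_all _ fun x h => absurd h hr
    filter_upwards [h] with x hx c hc
    obtain ⟨r, hr, hrc⟩ := exists_rat_btwn hc
    obtain ⟨q, hq, hqc⟩ := exists_rat_btwn hrc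
    exact (hx r hr q hq).mono fun n hn => hn.trans_lt hqc
  have hbneg : Bornology.IsBounded (Set.range (-f)) := by
    obtain ⟨K, hK⟩ := hb.exists_norm_le
    refine isBounded_iff_forall_norm_le.2 ⟨K, ?_⟩
    rintro _ ⟨x, rfl⟩
    simpa using hK _ ⟨x, rfl⟩
  -- The upper bound for `-f` is the lower bound for `f`.
  filter_upwards [upper f hfm hb, upper (-f) hfm.neg hbneg] with x h1 h2
  refine tendsto_order.2 ⟨fun c hc => ?_, h1⟩
  have h3 := h2 (-c) (by simpa [integral_neg] using hc)
  refine h3.mono fun n hn => ?_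
  have : birkhoffAverage ℝ T (-f) n x = -birkhoffAverage ℝ T f n x := by
    simp [birkhoffAverage, birkhoffSum]
  linarith

end Birkhoff

end ErgodicVC

namespace ErgodicVC

/-! ### Finite bracketing numbers from finite VC dimension. -/

section Bracketing

variable {S : Type*}

/-- If `𝒞` contains a Boolean independent family indexed by the subsets of `Fin k`, then it
shatters a set of `k` points. -/
theorem exists_shatters_of_independent {𝒞 : Set (Set S)} {k : ℕ}
    (F : Finset (Fin k) → Set S) (hF : ∀ T, F T ∈ 𝒞)
    (hind : ∀ s : Set (Finset (Fin k)), ∃ x, ∀ T, x ∈ F T ↔ T ∈ s) :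
    ∃ D : Finset S, D.card = k ∧ Shatters 𝒞 D := by
  classical
  choose x hx using hind
  -- The point `d a` lies in exactly those `F T` with `a ∈ T`, so `F T` cuts out the points indexed
  -- by `T`.
  let d : Fin k → S := fun a => x {T | a ∈ T}
  have hd : ∀ a T, d a ∈ F T ↔ a ∈ T := fun a T => hx _ T
  have hinj : Function.Injective d := by
    intro a b hab
    have h1 := (hd a {a}).2 (Finset.mem_singleton_self a)
    rw [hab, hd] at h1
    exact (Finset.mem_singleton.1 h1).symm
  refine ⟨Finset.univ.image d, ?_, ?_⟩
  · rw [Finset.card_image_of_injective _ hinj, Finset.card_univ, Fintype.card_fin]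
  · have himage : (fun C : Set S => C ∩ ((Finset.univ.image d : Finset S) : Set S)) '' 𝒞
        = 𝒫 ((Finset.univ.image d : Finset S) : Set S) := by
      ext B
      constructor
      · rintro ⟨C, -, rfl⟩
        exact Set.inter_subset_right
      · intro hB
        refine ⟨F (Finset.univ.filter fun a => d a ∈ B), hF _, ?_⟩
        ext y
        constructor
        · rintro ⟨hy, hyD⟩
          obtain ⟨a, -, rfl⟩ := Finset.mem_image.1 (Finset.mem_coe.1 hyD)
          simpa [hd] using hy
        · intro hy
          obtain ⟨a, -, rfl⟩ := Finset.mem_image.1 (Finset.mem_coe.1 (hB hy))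
          exact ⟨by simpa [hd] using hy, hB hy⟩
    rw [Shatters, shatterCoeff, himage, Set.ncard_powerset _ (Finset.finite_toSet _),
      Set.ncard_coe_finset]

variable [MeasurableSpace S]

/-- If almost every set along `𝒰` splits every non-null subset of `W`, then `𝒰`-large families
contain Boolean independent families of any finite size. -/
theorem exists_independent_of_splits {μ : Measure S} {𝒰 : Filter (Set S)} [𝒰.NeBot]
    {𝒞 : Set (Set S)} (h𝒰 : 𝒞 ∈ 𝒰) (hmeas : ∀ C ∈ 𝒞, MeasurableSet C) {W : Set S}
    (hW : MeasurableSet W) (hW0 : μ W ≠ 0)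
    (hsplit : ∀ A ⊆ W, MeasurableSet A → μ A ≠ 0 →
      ∀ᶠ C in 𝒰, μ (A ∩ C) ≠ 0 ∧ μ (A \ C) ≠ 0)
    {ι : Type*} [Finite ι] :
    ∃ F : ι → Set S, (∀ i, F i ∈ 𝒞) ∧ ∀ s : Set ι, ∃ x, ∀ i, x ∈ F i ↔ i ∈ s := by
  classical
  -- The induction keeps the cells non-null, not merely nonempty, so that `hsplit` applies to each
  -- of them.
  suffices h : ∀ t : Set ι, t.Finite → ∃ F : ι → Set S, (∀ i, F i ∈ 𝒞) ∧
      ∀ s : Set ι, μ (W ∩ {x | ∀ i ∈ t, x ∈ F i ↔ i ∈ s}) ≠ 0 by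
    obtain ⟨F, hF, hFs⟩ := h Set.univ Set.finite_univ
    refine ⟨F, hF, fun s => ?_⟩
    obtain ⟨x, -, hx⟩ := nonempty_of_measure_ne_zero (hFs s)
    exact ⟨x, fun i => hx i trivial⟩
  intro t ht
  induction t, ht using Set.Finite.induction_on with
  | empty =>
    obtain ⟨C, hC⟩ := nonempty_of_mem h𝒰
    exact ⟨fun _ => C, fun _ => hC, fun s => by simpa using hW0⟩
  | @insert a t hat _ ih =>
    obtain ⟨F, hF, hFs⟩ := ih
    have hcell : ∀ s : Set ι, MeasurableSet (W ∩ {x | ∀ i ∈ t, x ∈ F i ↔ i ∈ s}) := by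
      intro s
      refine hW.inter ?_
      have : {x | ∀ i ∈ t, x ∈ F i ↔ i ∈ s} = ⋂ i ∈ t, {x | x ∈ F i ↔ i ∈ s} := by
        ext x; simp
      rw [this]
      refine .biInter (Set.to_countable t) fun i _ => ?_
      by_cases his : i ∈ s
      · simpa [his] using hmeas _ (hF i)
      · simp only [his, iff_false]
        exact (hmeas _ (hF i)).compl
    -- There are finitely many cells, so a single `C` splits them all.
    have hev : ∀ᶠ C in 𝒰, ∀ s : Set ι,
        μ ((W ∩ {x | ∀ i ∈ t, x ∈ F i ↔ i ∈ s}) ∩ C) ≠ 0 ∧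
        μ ((W ∩ {x | ∀ i ∈ t, x ∈ F i ↔ i ∈ s}) \ C) ≠ 0 :=
      eventually_all.2 fun s => hsplit _ Set.inter_subset_left (hcell s) (hFs s)
    obtain ⟨C, hC, hC𝒞⟩ := (hev.and h𝒰).exists
    refine ⟨Function.update F a C, fun i => ?_, fun s => ?_⟩
    · by_cases hi : i = a
      · subst hi
        rw [Function.update_self]
        exact hC𝒞
      · simpa [hi] using hF i
    · have hne : ∀ i ∈ t, i ≠ a := fun i hi h => hat (h ▸ hi)
      by_cases has : a ∈ s
      · refine fun h0 => (hC s).1 (measure_mono_null ?_ h0)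
        rintro x ⟨⟨hxW, hx⟩, hxC⟩
        refine ⟨hxW, fun i hi => ?_⟩
        rcases hi with rfl | hi
        · simp [hxC, has]
        · simpa [hne i hi] using hx i hi
      · refine fun h0 => (hC s).2 (measure_mono_null ?_ h0)
        rintro x ⟨⟨hxW, hx⟩, hxC⟩
        refine ⟨hxW, fun i hi => ?_⟩
        rcases hi with rfl | hi
        · simp [hxC, has]
        · simpa [hne i hi] using hx i hi

/-- A class of sets that is closed under binary unions has an essential supremum: a countable
union of members outside of which every member is null. -/
theorem exists_seq_mem_forall_disjoint_null (μ : Measure S) [IsFiniteMeasure μ]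
    (𝒟 : Set (Set S)) (hm : ∀ D ∈ 𝒟, MeasurableSet D) (h0 : ∅ ∈ 𝒟)
    (hU : ∀ D ∈ 𝒟, ∀ E ∈ 𝒟, D ∪ E ∈ 𝒟) :
    ∃ D : ℕ → Set S, Monotone D ∧ (∀ n, D n ∈ 𝒟) ∧
      ∀ A ∈ 𝒟, A ⊆ (⋃ n, D n)ᶜ → μ A = 0 := by
  obtain ⟨u, -, hu, huv⟩ := exists_seq_tendsto_sSup (S := μ '' 𝒟) ⟨_, ∅, h0, rfl⟩
    (OrderTop.bddAbove _)
  choose D hD hDu using huv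
  have hacc : ∀ n, Set.accumulate D n ∈ 𝒟 := by
    intro n
    induction n with
    | zero => simpa [Set.accumulate_def] using hD 0
    | succ n ih => rw [Set.accumulate_succ]; exact hU _ ih _ (hD _)
  refine ⟨Set.accumulate D, Set.monotone_accumulate, hacc, fun A hA hAD => ?_⟩
  rw [Set.iUnion_accumulate] at hAD
  have hfin : sSup (μ '' 𝒟) ≠ ∞ := by
    refine ne_top_of_le_ne_top (measure_ne_top μ Set.univ) (sSup_le ?_)
    rintro _ ⟨B, -, rfl⟩
    exact measure_mono (Set.subset_univ _)
  -- Each `D n` is disjoint from `A` and their union is again in `𝒟`; letting `n` grow leaves no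
  -- room for `μ A > 0`, the supremum being finite.
  have hle : ∀ n, u n + μ A ≤ sSup (μ '' 𝒟) := by
    intro n
    rw [← hDu n, ← measure_union _ (hm A hA)]
    · exact le_sSup ⟨_, hU _ (hD n) _ hA, rfl⟩
    · exact Set.disjoint_left.2 fun x hx hxA => hAD hxA (Set.mem_iUnion.2 ⟨n, hx⟩)
  have hlim := le_of_tendsto' (hu.add_const (μ A)) hle
  have h : sSup (μ '' 𝒟) + μ A ≤ sSup (μ '' 𝒟) + 0 := by simpa using hlim
  simpa using (ENNReal.add_le_add_iff_left hfin).1 h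

/-- Along an ultrafilter, the sets of a family of finite VC dimension agree almost everywhere
with a fixed set, off a set of small measure. -/
theorem exists_eventually_ae_mem_iff (μ : Measure S) [IsFiniteMeasure μ] {𝒞 : Set (Set S)}
    (hmeas : ∀ C ∈ 𝒞, MeasurableSet C) (hdim : vcDim 𝒞 < ⊤)
    (𝒰 : Ultrafilter (Set S)) (h𝒰 : 𝒞 ∈ 𝒰) {ε : ℝ≥0∞} (hε : 0 < ε) :
    ∃ D L : Set S, MeasurableSet D ∧ MeasurableSet L ∧ μ Dᶜ < ε ∧
      ∀ᶠ C in (𝒰 : Filter (Set S)), ∀ᵐ x ∂μ, x ∈ D → (x ∈ C ↔ x ∈ L) := by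
  -- The regions on which the sets `C` stabilise a.e. along `𝒰`. Gluing the limit sets makes this
  -- class closed under unions.
  let 𝒟 : Set (Set S) := {D | MeasurableSet D ∧ ∃ L, MeasurableSet L ∧
    ∀ᶠ C in (𝒰 : Filter (Set S)), ∀ᵐ x ∂μ, x ∈ D → (x ∈ C ↔ x ∈ L)}
  obtain ⟨D, hDmono, hD, hmax⟩ := exists_seq_mem_forall_disjoint_null μ 𝒟 (fun D h => h.1)
    ⟨.empty, ∅, .empty, by simp⟩ (by
      rintro D ⟨hD, L, hL, h⟩ E ⟨hE, K, hK, h'⟩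
      refine ⟨hD.union hE, (L ∩ D) ∪ (K \ D), (hL.inter hD).union (hK.diff hD), ?_⟩
      filter_upwards [h, h'] with C h1 h2
      filter_upwards [h1, h2] with x h3 h4 hx
      by_cases hxD : x ∈ D
      · simp [hxD, h3 hxD]
      · simp [hxD, h4 (hx.resolve_left hxD)])
  have hWm : MeasurableSet (⋃ n, D n)ᶜ := (MeasurableSet.iUnion fun n => (hD n).1).compl
  have hW : μ (⋃ n, D n)ᶜ = 0 := by
    by_contra hW0
    -- For an ultrafilter, failing to split `A` eventually means that eventually `C` misses `A` a.e.
    -- or eventually contains it a.e. Then `A` belongs to `𝒟`, with limit `∅` or `Set.univ`, against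
    -- maximality.
    have hsplit : ∀ A ⊆ (⋃ n, D n)ᶜ, MeasurableSet A → μ A ≠ 0 →
        ∀ᶠ C in (𝒰 : Filter (Set S)), μ (A ∩ C) ≠ 0 ∧ μ (A \ C) ≠ 0 := by
      intro A hAW hA hA0
      refine Filter.Eventually.and ?_ ?_
      · refine Ultrafilter.eventually_not.2 fun h => hA0 (hmax A ⟨hA, ∅, .empty, ?_⟩ hAW)
        filter_upwards [h] with C hC
        filter_upwards [measure_eq_zero_iff_ae_notMem.1 hC] with x hx hxA
        simpa [hxA] using hx
      · refine Ultrafilter.eventually_not.2 fun h => hA0 (hmax A ⟨hA, Set.univ, .univ, ?_⟩ hAW)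
        filter_upwards [h] with C hC
        filter_upwards [measure_eq_zero_iff_ae_notMem.1 hC] with x hx hxA
        simpa [hxA] using hx
    obtain ⟨V, hV⟩ := ENat.ne_top_iff_exists.1 hdim.ne
    -- Indexing by the subsets of `V + 1` points yields a shattered set one larger than the VC
    -- dimension allows.
    obtain ⟨F, hF, hind⟩ := exists_independent_of_splits (ι := Finset (Fin (V + 1)))
      (𝒰 := (𝒰 : Filter (Set S))) h𝒰 hmeas hWm hW0 hsplit
    obtain ⟨E, hE, hEs⟩ := exists_shatters_of_independent F hF hind
    have hle : (E.card : ℕ∞) ≤ vcDim 𝒞 :=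
      le_iSup₂ (f := fun (D : Finset S) (_ : Shatters 𝒞 D) => (D.card : ℕ∞)) E hEs
    rw [← hV, hE] at hle
    have : V + 1 ≤ V := by exact_mod_cast hle
    omega
  have hlim : Tendsto (fun n => μ (D n)ᶜ) atTop (𝓝 0) := by
    have := tendsto_measure_iInter_atTop (μ := μ) (s := fun n => (D n)ᶜ)
      (fun n => (hD n).1.compl.nullMeasurableSet)
      (fun m n hmn => Set.compl_subset_compl.2 (hDmono hmn)) ⟨0, measure_ne_top _ _⟩
    rwa [← Set.compl_iUnion, hW] at this
  obtain ⟨n, hn⟩ := (hlim.eventually_lt_const hε).exists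
  obtain ⟨hDn, L, hL, h⟩ := hD n
  exact ⟨D n, L, hDn, hL, hn, h⟩

/-- A family of measurable sets with finite VC dimension has finite bracketing numbers. -/
theorem exists_finite_brackets (μ : Measure S) [IsFiniteMeasure μ] {𝒞 : Set (Set S)}
    (hmeas : ∀ C ∈ 𝒞, MeasurableSet C) (hdim : vcDim 𝒞 < ⊤) {ε : ℝ≥0∞} (hε : 0 < ε) :
    ∃ t : Finset (Set S × Set S),
      (∀ p ∈ t, MeasurableSet p.1 ∧ MeasurableSet p.2 ∧ μ (p.2 \ p.1) < ε) ∧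
      ∀ C ∈ 𝒞, ∃ p ∈ t, p.1 ≤ᵐ[μ] C ∧ C ≤ᵐ[μ] p.2 := by
  classical
  let B := {p : Set S × Set S // MeasurableSet p.1 ∧ MeasurableSet p.2 ∧ μ (p.2 \ p.1) < ε}
  let O : B → Set (Ultrafilter (Set S)) := fun p =>
    {𝒰 | {C | p.1.1 ≤ᵐ[μ] C ∧ C ≤ᵐ[μ] p.1.2} ∈ 𝒰}
  -- Each bracket defines a basic open set of ultrafilters. The principal ultrafilters at members of
  -- `𝒞` lie in this compact set, so a finite subcover brackets every member.
  have hcompact : IsCompact {𝒰 : Ultrafilter (Set S) | 𝒞 ∈ 𝒰} :=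
    (ultrafilter_isClosed_basic 𝒞).isCompact
  obtain ⟨t, ht⟩ := hcompact.elim_finite_subcover O (fun p => ultrafilter_isOpen_basic _) (by
    intro 𝒰 h𝒰
    obtain ⟨D, L, hD, hL, hDε, hev⟩ := exists_eventually_ae_mem_iff μ hmeas hdim 𝒰 h𝒰 hε
    -- Nothing is known off `D`, so the bracket excludes `Dᶜ` below and includes it above; its gap
    -- lies in `Dᶜ`.
    refine Set.mem_iUnion.2 ⟨⟨(L ∩ D, L ∪ Dᶜ), hL.inter hD, hL.union hD.compl,
      lt_of_le_of_lt (measure_mono ?_) hDε⟩, ?_⟩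
    · rintro x ⟨hx | hx, hx'⟩
      · exact fun hxD => hx' ⟨hx, hxD⟩
      · exact hx
    · filter_upwards [hev] with C hC
      constructor
      · filter_upwards [hC] with x hx hxL
        exact (hx hxL.2).2 hxL.1
      · filter_upwards [hC] with x hx hxC
        by_cases hxD : x ∈ D
        · exact Or.inl ((hx hxD).1 hxC)
        · exact Or.inr hxD)
  refine ⟨t.image Subtype.val, ?_, fun C hC => ?_⟩
  · intro p hp
    obtain ⟨q, -, rfl⟩ := Finset.mem_image.1 hp
    exact q.2
  · have hpure : (pure C : Ultrafilter (Set S)) ∈ {𝒰 : Ultrafilter (Set S) | 𝒞 ∈ 𝒰} :=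
      Ultrafilter.mem_pure.2 hC
    obtain ⟨p, hpt, hp⟩ := Set.mem_iUnion₂.1 (ht hpure)
    exact ⟨p.1, Finset.mem_image_of_mem _ hpt, Ultrafilter.mem_pure.1 hp⟩

end Bracketing

end ErgodicVC

namespace ErgodicVC

/-! ### From the ergodic theorem and brackets to uniform convergence. -/

section Sampling

variable {Ω S : Type*} {X : ℕ → Ω → S}

theorem shift_iterate_apply (k : ℕ) (x : ℕ → S) (n : ℕ) : (shift^[k] x) n = x (n + k) := by
  induction k generalizing x with
  | zero => rfl
  | succ k ih =>
    rw [Function.iterate_succ_apply, ih, shift, add_assoc]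

theorem relFreq_le_relFreq {A B : Set S} {ω : Ω} (h : ∀ n, X n ω ∈ A → X n ω ∈ B) (m : ℕ) :
    relFreq X A m ω ≤ relFreq X B m ω := by
  refine mul_le_mul_of_nonneg_left (Finset.sum_le_sum fun i _ => ?_) (by positivity)
  by_cases hA : X i ω ∈ A
  · simp [hA, h i hA]
  · rw [Set.indicator_of_notMem hA]
    exact Set.indicator_nonneg (fun _ _ => zero_le_one) _

variable [MeasurableSpace Ω] [MeasurableSpace S] {P : Measure Ω}

theorem measurable_shift : Measurable (shift : (ℕ → S) → ℕ → S) :=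
  measurable_pi_lambda _ fun n => measurable_pi_apply (n + 1)

theorem IsStationary.map_apply_eq (hstat : IsStationary X P) (n : ℕ) :
    P.map (X n) = P.map (X 0) := by
  induction n with
  | zero => rfl
  | succ n ih =>
    rw [← ih]
    exact (hstat.comp (measurable_pi_apply n)).map_eq

/-- The shift is ergodic for the law of a stationary ergodic process. -/
theorem ergodic_shift [IsProbabilityMeasure P] (hX : ∀ n, Measurable (X n))
    (hstat : IsStationary X P) (herg : IsErgodic X P) :
    Ergodic shift (P.map fun ω n => X n ω) := by
  have hpath : Measurable fun ω n => X n ω := measurable_pi_lambda _ hX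
  refine { measurable := measurable_shift, map_eq := ?_, aeconst_set := fun B hB hinv => ?_ }
  · rw [Measure.map_map measurable_shift hpath]
    exact IdentDistrib.map_eq hstat
  · rw [eventuallyConst_set']
    have : IsProbabilityMeasure (P.map fun ω n => X n ω) :=
      Measure.isProbabilityMeasure_map hpath.aemeasurable
    rcases herg B hB hinv with h | h
    · left
      rw [ae_eq_empty, Measure.map_apply hpath hB]
      exact h
    · right
      rw [ae_eq_univ, prob_compl_eq_zero_iff hB, Measure.map_apply hpath hB]
      exact h

/-- The relative frequency of a measurable set converges almost surely to its probability. -/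
theorem ae_tendsto_relFreq [IsProbabilityMeasure P] (hX : ∀ n, Measurable (X n))
    (hstat : IsStationary X P) (herg : IsErgodic X P) {C : Set S} (hC : MeasurableSet C) :
    ∀ᵐ ω ∂P, Tendsto (fun m => relFreq X C m ω) atTop (𝓝 ((P.map (X 0)).real C)) := by
  have hpath : Measurable fun ω n => X n ω := measurable_pi_lambda _ hX
  have hprob : IsProbabilityMeasure (P.map fun ω n => X n ω) :=
    Measure.isProbabilityMeasure_map hpath.aemeasurable
  set f : (ℕ → S) → ℝ := fun x => C.indicator (fun _ => (1 : ℝ)) (x 0) with hf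
  have hfm : Measurable f := (measurable_const.indicator hC).comp (measurable_pi_apply 0)
  have hfb : Bornology.IsBounded (Set.range f) := by
    refine isBounded_iff_forall_norm_le.2 ⟨1, ?_⟩
    rintro _ ⟨x, rfl⟩
    by_cases hx : x 0 ∈ C <;> simp [hf, hx]
  have hint : ∫ x, f x ∂(P.map fun ω n => X n ω) = (P.map (X 0)).real C := by
    rw [integral_map hpath.aemeasurable hfm.aestronglyMeasurable,
      ← integral_map (φ := X 0) (f := C.indicator fun _ => (1 : ℝ)) (hX 0).aemeasurable
        (measurable_const.indicator hC).aestronglyMeasurable]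
    exact integral_indicator_one hC
  have h := ae_of_ae_map hpath.aemeasurable
    (ae_tendsto_birkhoffAverage (ergodic_shift hX hstat herg) hfm hfb)
  filter_upwards [h] with ω hω
  rw [hint] at hω
  refine hω.congr fun m => ?_
  simp [birkhoffAverage, birkhoffSum, relFreq, hf, shift_iterate_apply]

theorem IsStationary.ae_forall_mem_imp (hX : ∀ n, Measurable (X n)) (hstat : IsStationary X P)
    {A B : Set S} (h : A ≤ᵐ[P.map (X 0)] B) : ∀ᵐ ω ∂P, ∀ n, X n ω ∈ A → X n ω ∈ B := by
  refine ae_all_iff.2 fun n => ae_of_ae_map (p := fun x => x ∈ A → x ∈ B) (hX n).aemeasurable ?_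
  rw [hstat.map_apply_eq n]
  exact h

/-- Half of `ε` pays for the width of the brackets, half for the fluctuation of the frequencies of
their finitely many endpoints. -/
theorem ae_eventually_Gam_le [IsProbabilityMeasure P] (hX : ∀ n, Measurable (X n))
    (hstat : IsStationary X P) (herg : IsErgodic X P) {𝒞 : Set (Set S)} (h𝒞 : 𝒞.Countable)
    (hmeas : ∀ C ∈ 𝒞, MeasurableSet C) (hdim : vcDim 𝒞 < ⊤) {ε : ℝ} (hε : 0 < ε) :
    ∀ᵐ ω ∂P, ∀ᶠ m in atTop, Gam P 𝒞 X m ω ≤ ε := by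
  set μ := P.map (X 0) with hμ
  have hprob : IsProbabilityMeasure μ := Measure.isProbabilityMeasure_map (hX 0).aemeasurable
  obtain ⟨t, ht, hcover⟩ := exists_finite_brackets μ hmeas hdim
    (ε := ENNReal.ofReal (ε / 2)) (by simpa using hε)
  have hfreq : ∀ᵐ ω ∂P, ∀ p ∈ t,
      Tendsto (fun m => relFreq X p.1 m ω) atTop (𝓝 (μ.real p.1)) ∧
      Tendsto (fun m => relFreq X p.2 m ω) atTop (𝓝 (μ.real p.2)) := by
    refine (ae_ball_iff t.countable_toSet).2 fun p hp => ?_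
    exact (ae_tendsto_relFreq hX hstat herg (ht p hp).1).and
      (ae_tendsto_relFreq hX hstat herg (ht p hp).2.1)
  -- Countability of `𝒞` gives one null set of paths off which the a.e. inclusions hold along the
  -- whole path, for every `C` at once.
  have hbr : ∀ᵐ ω ∂P, ∀ C ∈ 𝒞, ∃ p ∈ t, p.1 ≤ᵐ[μ] C ∧ C ≤ᵐ[μ] p.2 ∧
      (∀ n, X n ω ∈ p.1 → X n ω ∈ C) ∧ ∀ n, X n ω ∈ C → X n ω ∈ p.2 := by
    refine (ae_ball_iff h𝒞).2 fun C hC => ?_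
    obtain ⟨p, hp, h1, h2⟩ := hcover C hC
    filter_upwards [hstat.ae_forall_mem_imp hX h1, hstat.ae_forall_mem_imp hX h2] with ω h3 h4
    exact ⟨p, hp, h1, h2, h3, h4⟩
  filter_upwards [hfreq, hbr] with ω hω hωbr
  have hev : ∀ᶠ m in atTop, ∀ p ∈ t, μ.real p.1 - ε / 2 < relFreq X p.1 m ω ∧
      relFreq X p.2 m ω < μ.real p.2 + ε / 2 := by
    refine (eventually_all_finset t).2 fun p hp => ?_
    exact ((hω p hp).1.eventually_const_lt (by linarith)).and
      ((hω p hp).2.eventually_lt_const (by linarith))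
  filter_upwards [hev] with m hm
  -- The bound `0 ≤ ε` covers empty `𝒞`, where the real supremum is `0` by convention.
  refine Real.iSup_le (fun C => ?_) hε.le
  obtain ⟨p, hp, h1, h2, h3, h4⟩ := hωbr C C.2
  have hPC : P.real {ω' | X 0 ω' ∈ (C : Set S)} = μ.real C :=
    (map_measureReal_apply (hX 0) (hmeas C C.2)).symm
  have hle1 : μ.real p.1 ≤ μ.real C :=
    ENNReal.toReal_mono (measure_ne_top _ _) (measure_mono_ae h1)
  have hle2 : μ.real C ≤ μ.real p.2 :=
    ENNReal.toReal_mono (measure_ne_top _ _) (measure_mono_ae h2)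
  have hgap : μ.real p.2 ≤ μ.real p.1 + ε / 2 := by
    have h5 : μ.real (p.2 \ p.1) ≤ ε / 2 :=
      ENNReal.toReal_le_of_le_ofReal (by linarith) (ht p hp).2.2.le
    have h6 : μ.real p.2 ≤ μ.real p.1 + μ.real (p.2 \ p.1) := by
      refine (measureReal_mono ?_).trans (measureReal_union_le _ _)
      rw [Set.union_sdiff_self]
      exact Set.subset_union_right
    linarith
  rw [hPC, abs_le]
  have := relFreq_le_relFreq h3 m
  have := relFreq_le_relFreq h4 m
  have := hm p hp
  constructor <;> linarith

end Sampling

end ErgodicVC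

theorem theorem1 {S : Type*} [MetricSpace S] [CompleteSpace S]
    [TopologicalSpace.SeparableSpace S] [MeasurableSpace S] [BorelSpace S]
    (𝒞 : Set (Set S)) (h𝒞 : 𝒞.Countable) (hmeas : ∀ C ∈ 𝒞, MeasurableSet C)
    (hdim : ErgodicVC.vcDim 𝒞 < ⊤)
    {Ω : Type*} [MeasurableSpace Ω] (P : Measure Ω) [IsProbabilityMeasure P]
    (X : ℕ → Ω → S) (hX : ∀ n, Measurable (X n))
    (hstat : ErgodicVC.IsStationary X P) (herg : ErgodicVC.IsErgodic X P) :
    ErgodicVC.IsGlivenkoCantelli P 𝒞 X := by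
  have h : ∀ᵐ ω ∂P, ∀ k : ℕ, ∀ᶠ m in atTop, ErgodicVC.Gam P 𝒞 X m ω ≤ 1 / ((k : ℝ) + 1) :=
    ae_all_iff.2 fun k =>
      ErgodicVC.ae_eventually_Gam_le hX hstat herg h𝒞 hmeas hdim Nat.one_div_pos_of_nat
  filter_upwards [h] with ω hω
  refine tendsto_order.2 ⟨fun a ha => .of_forall fun m => ?_, fun a ha => ?_⟩
  · exact ha.trans_le (Real.iSup_nonneg fun C => abs_nonneg _)
  · obtain ⟨k, hk⟩ := exists_nat_one_div_lt ha
    exact (hω k).mono fun m hm => hm.trans_lt hk
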